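/- Let $R$ be a commutative Noetherian semiperfect ring (that is, $R$ is semisimple modulo its Jacobson radical and idempotents lift modulo it; equivalently, $R$ is a finite direct product of local rings), and let $C$ be a semidualizing $R$-module: $C$ is finitely generated, the homothety map $R\to\mathrm{Hom}_R(C,C)$ is an isomorphism, and $\mathrm{Ext}^i_R(C,C)=0$ for all $i>0$. Definitions. A finitely generated $R$-module $X$ is totally $C$-reflexive if the biduality map $X\to\mathrm{Hom}_R(\mathrm{Hom}_R(X,C),C)$ is an isomorphism and $\mathrm{Ext}^i_R(X,C)=0=\mathrm{Ext}^i_R(\mathrm{Hom}_R(X,C),C)$ for all $i>0$; $\mathrm{G}_C\text{-}\dim_R(M)$ is the least $n\ge 0$ such that there is an exact sequence $0\to X_n\to\cdots\to X_0\to M\to 0$ with all $X_i$ totally $C$-reflexive (and $\infty$ if there is none). A finitely generated module is stable if it has no non-zero projective direct summand. For a finitely generated $R$-module $M$ with minimal projective presentation $P_1\xrightarrow{f}P_0\to M\to 0$, put $\mathrm{Tr}(M)=\mathrm{Coker}\big(\mathrm{Hom}_R(f,R)\colon \mathrm{Hom}_R(P_0,R)\to \mathrm{Hom}_R(P_1,R)\big)$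 and let $\lambda M=\Omega\,\mathrm{Tr}(M)$ be the kernel of a projective cover of $\mathrm{Tr}(M)$; it is unique up to isomorphism. $M$ is horizontally linked if $M\cong\lambda(\lambda M)$. The Auslander class $\mathcal A_C$ consists of the $R$-modules $N$ such that the natural map $N\to\mathrm{Hom}_R(C,N\otimes_R C)$ is an isomorphism and $\mathrm{Tor}_i^R(C,N)=0=\mathrm{Ext}^i_R(C,N\otimes_R C)$ for all $i>0$. Theorem. Let $M$ be a stable (finitely generated) $R$-module such that $\mathrm{G}_C\text{-}\dim_R(M)=0$ and $\lambda M\in\mathcal A_C$. Then $M$ is horizontally linked, $\lambda M$ is stable, and $\mathrm{G}_C\text{-}\dim_R(\lambda M\otimes_R C)=0$. -/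

import Mathlib

open TensorProduct

universe u

namespace Linkage

/-- A commutative ring is semiperfect if it is semisimple modulo its Jacobson radical and
idempotents lift modulo the Jacobson radical. -/
def IsSemiperfect (R : Type u) [CommRing R] : Prop :=
  IsSemisimpleRing (R ⧸ Ring.jacobson R) ∧
    ∀ e : R ⧸ Ring.jacobson R, IsIdempotentElem e →
      ∃ e' : R, IsIdempotentElem e' ∧ Ideal.Quotient.mk (Ring.jacobson R) e' = e

section Homological

variable (R : Type u) [CommRing R]

/-- `Ext^i_R(M, N) = 0`. -/
def ExtVanishes (i : ℕ) (M N : Type u) [AddCommGroup M] [Module R M]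
    [AddCommGroup N] [Module R N] : Prop :=
  Subsingleton (CategoryTheory.Abelian.Ext (ModuleCat.of R M) (ModuleCat.of R N) i)

/-- `Tor_i^R(M, N) = 0`. -/
def TorVanishes (i : ℕ) (M N : Type u) [AddCommGroup M] [Module R M]
    [AddCommGroup N] [Module R N] : Prop :=
  CategoryTheory.Limits.IsZero
    (((CategoryTheory.Tor (ModuleCat.{u} R) i).obj (ModuleCat.of R M)).obj (ModuleCat.of R N))

/-- Semidualizing modules: finite, the homothety map `R → Hom_R(C, C)` is an isomorphism, and
`Ext^i_R(C, C) = 0` for all `i > 0`. -/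
structure IsSemidualizing (C : Type u) [AddCommGroup C] [Module R C] : Prop where
  finite : Module.Finite R C
  homothety_bijective : Function.Bijective (LinearMap.lsmul R C : R → C →ₗ[R] C)
  ext_self : ∀ i : ℕ, 0 < i → ExtVanishes R i C C

/-- Totally `C`-reflexive modules. Here `LinearMap.applyₗ` is the biduality map
`M → Hom_R(Hom_R(M, C), C)`, `x ↦ (f ↦ f x)`. -/
structure IsTotallyReflexive (C M : Type u) [AddCommGroup C] [Module R C]
    [AddCommGroup M] [Module R M] : Prop where
  finite : Module.Finite R M
  biduality_bijective :
    Function.Bijective (LinearMap.applyₗ : M →ₗ[R] (M →ₗ[R] C) →ₗ[R] C)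
  ext_self : ∀ i : ℕ, 0 < i → ExtVanishes R i M C
  ext_dual : ∀ i : ℕ, 0 < i → ExtVanishes R i (M →ₗ[R] C) C

/-- There is an exact sequence `0 → X_n → ⋯ → X_0 → M → 0` with all `X_i` totally
`C`-reflexive (written as an infinite sequence with `X_i = 0` for `i > n`). -/
def HasGResolution (C M : Type u) [AddCommGroup C] [Module R C]
    [AddCommGroup M] [Module R M] (n : ℕ) : Prop :=
  ∃ (X : ℕ → ModuleCat.{u} R) (d : ∀ i, X (i + 1) →ₗ[R] X i) (ε : X 0 →ₗ[R] M),
    (∀ i, i ≤ n → IsTotallyReflexive R C (X i)) ∧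
    (∀ i, n < i → Subsingleton (X i)) ∧
    Function.Surjective ε ∧
    Function.Exact (d 0) ε ∧
    ∀ i, Function.Exact (d (i + 1)) (d i)

/-- The `G_C`-dimension of `M`: the least length of a finite resolution by totally
`C`-reflexive modules, and `⊤` if there is none. -/
noncomputable def gDim (C M : Type u) [AddCommGroup C] [Module R C]
    [AddCommGroup M] [Module R M] : ℕ∞ :=
  ⨅ (n : ℕ) (_ : HasGResolution R C M n), (n : ℕ∞)

/-- The Auslander class of `C`. Here `TensorProduct.mk R M C` is the natural map
`M → Hom_R(C, M ⊗ C)`, `x ↦ (c ↦ x ⊗ c)`. -/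
structure InAuslanderClass (C M : Type u) [AddCommGroup C] [Module R C]
    [AddCommGroup M] [Module R M] : Prop where
  unit_bijective : Function.Bijective (TensorProduct.mk R M C : M → C →ₗ[R] M ⊗[R] C)
  tor : ∀ i : ℕ, 0 < i → TorVanishes R i C M
  ext_tensor : ∀ i : ℕ, 0 < i → ExtVanishes R i C (M ⊗[R] C)

end Homological

section Horizontal

variable (R : Type u) [CommRing R]

/-- A finite module is stable if it has no non-zero projective direct summand. -/
structure IsStable (M : Type u) [AddCommGroup M] [Module R M] : Prop where
  finite : Module.Finite R M
  no_summand : ∀ P Q : Submodule R M, IsCompl P Q → Module.Projective R P → P = ⊥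

variable {R}

/-- `N` is a superfluous (small) submodule of `M`. -/
def IsSuperfluous {M : Type u} [AddCommGroup M] [Module R M] (N : Submodule R M) : Prop :=
  ∀ K : Submodule R M, N ⊔ K = ⊤ → K = ⊤

/-- `π : P → M` is a projective cover. -/
structure IsProjectiveCover {P M : Type u} [AddCommGroup P] [Module R P]
    [AddCommGroup M] [Module R M] (π : P →ₗ[R] M) : Prop where
  projective : Module.Projective R P
  surjective : Function.Surjective π
  superfluous : IsSuperfluous (LinearMap.ker π)

/-- `P₁ → P₀ → M → 0` is a minimal projective presentation: `P₀ → M` is a projective cover and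
`f` induces a projective cover `P₁ → ker π`. -/
structure IsMinimalPresentation {P₁ P₀ M : Type u} [AddCommGroup P₁] [Module R P₁]
    [AddCommGroup P₀] [Module R P₀] [AddCommGroup M] [Module R M]
    (f : P₁ →ₗ[R] P₀) (π : P₀ →ₗ[R] M) : Prop where
  cover : IsProjectiveCover π
  exact : Function.Exact f π
  cover_ker : IsProjectiveCover
    (f.codRestrict (LinearMap.ker π) fun x => LinearMap.mem_ker.2 (exact.apply_apply_eq_zero x))

variable (R)

/-- `T` is isomorphic to the Auslander transpose `Tr M`, the cokernel of the `R`-dual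
`P₀* → P₁*` of a minimal projective presentation `P₁ → P₀ → M → 0`. -/
def IsTranspose (M T : Type u) [AddCommGroup M] [Module R M]
    [AddCommGroup T] [Module R T] : Prop :=
  ∃ (P₁ P₀ : ModuleCat.{u} R) (f : P₁ →ₗ[R] P₀) (π : P₀ →ₗ[R] M),
    IsMinimalPresentation f π ∧
    Nonempty (T ≃ₗ[R] (Module.Dual R P₁ ⧸ LinearMap.range f.dualMap))

/-- `L` is isomorphic to the syzygy module `Ω T`, the kernel of a projective cover of `T`. -/
def IsSyzygy (T L : Type u) [AddCommGroup T] [Module R T]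
    [AddCommGroup L] [Module R L] : Prop :=
  ∃ (P : ModuleCat.{u} R) (π : P →ₗ[R] T),
    IsProjectiveCover π ∧ Nonempty (L ≃ₗ[R] LinearMap.ker π)

/-- `L ≅ λ M = Ω Tr M`. Over a semiperfect Noetherian ring, `λ M` exists for every finite `M` and
is unique up to isomorphism. -/
def IsLambda (M L : Type u) [AddCommGroup M] [Module R M]
    [AddCommGroup L] [Module R L] : Prop :=
  ∃ T : ModuleCat.{u} R, IsTranspose R M T ∧ IsSyzygy R T L

/-- The modules `M` and `N` are horizontally linked: `M ≅ λ N` and `N ≅ λ M`. -/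
def AreHorizontallyLinked (M N : Type u) [AddCommGroup M] [Module R M]
    [AddCommGroup N] [Module R N] : Prop :=
  IsLambda R N M ∧ IsLambda R M N

/-- `M` is horizontally linked: `M` and `λ M` are horizontally linked, i.e. `M ≅ λ λ M`. -/
def IsHorizontallyLinked (M : Type u) [AddCommGroup M] [Module R M] : Prop :=
  ∃ L : ModuleCat.{u} R, IsLambda R M L ∧ AreHorizontallyLinked R M L

end Horizontal

end Linkage

/-! Let `P₁ → P₀ → M → 0` be a minimal presentation with maps `f`, `π`. Dualizing, `L = λM` is the
image of `f* : P₀* → P₁*`, which factors as `i ∘ p` with `p` onto and `i` injective.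

The heart is that `i ⊗ C` stays injective (`IsSemidualizing.rTensor_injective`). By the Auslander
class condition a map from `C` to its kernel has the form `c ↦ x ⊗ c`; then `i x = 0`, so `x = 0`.
Thus the kernel receives no non-zero map from the faithful finite module `C`, and it vanishes. Since
`P* ⊗ C = Hom(P, C)` for finite projective `P`, this gives the exact sequence `0 → Hom(M, C) →
Hom(P₀, C) → L ⊗ C → 0` (`exists_tensor_presentation`).

Its `C`-dual identifies `Hom(L ⊗ C, C)` with `ker π` (`exists_dual_equiv_ker`), and total
reflexivity passes from `M` to `L ⊗ C` by long exact sequences. Tensoring a functional on `L` with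
`C` shows that it is evaluation at a point of `ker π` (`exists_mem_ker_eval`). As `ker π` is
superfluous, these functionals take values in the Jacobson radical `J`, so `L` is stable. Stability
of `M` makes `p` a projective cover, and the equality `L* = ker π` gives `λL = P₀ / ker π = M`. -/

namespace Linkage

/-! ### Vanishing of `Ext` along short exact sequences. -/

section Ext

open CategoryTheory

variable {R : Type u} [CommRing R] {A B D N : Type u} [AddCommGroup A] [Module R A]
  [AddCommGroup B] [Module R B] [AddCommGroup D] [Module R D] [AddCommGroup N] [Module R N]

/-- A short exact sequence of modules gives a short exact complex in the category of modules. -/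
theorem exists_shortExact {a : A →ₗ[R] B} {b : B →ₗ[R] D} (ha : Function.Injective a)
    (hab : Function.Exact a b) (hb : Function.Surjective b) :
    ∃ w : ModuleCat.ofHom a ≫ ModuleCat.ofHom b = 0,
      (ShortComplex.mk (ModuleCat.ofHom a) (ModuleCat.ofHom b) w).ShortExact := by
  have w : ModuleCat.ofHom a ≫ ModuleCat.ofHom b = 0 := by
    ext x; exact hab.apply_apply_eq_zero x
  refine ⟨w, ?_⟩
  have h1 : Mono (ModuleCat.ofHom a) := (ModuleCat.mono_iff_injective _).2 ha
  have h2 : Epi (ModuleCat.ofHom b) := (ModuleCat.epi_iff_surjective _).2 hb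
  exact { exact := (ShortComplex.ShortExact.moduleCat_exact_iff_function_exact _).2 hab
          mono_f := h1, epi_g := h2 }

theorem ExtVanishes.of_exact_left {a : A →ₗ[R] B} {b : B →ₗ[R] D} (ha : Function.Injective a)
    (hab : Function.Exact a b) (hb : Function.Surjective b) {i : ℕ}
    (hB : ExtVanishes R i B N) (hD : ExtVanishes R (i + 1) D N) : ExtVanishes R i A N := by
  obtain ⟨w, hS⟩ := exists_shortExact ha hab hb
  refine subsingleton_of_forall_eq 0 fun x => ?_
  obtain ⟨y, rfl⟩ := Abelian.Ext.contravariant_sequence_exact₁ hS _ x (add_comm 1 i)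
    (@Subsingleton.elim _ hD _ _)
  rw [@Subsingleton.elim _ hB y 0, Abelian.Ext.comp_zero]

theorem ExtVanishes.of_exact_right {a : A →ₗ[R] B} {b : B →ₗ[R] D} (ha : Function.Injective a)
    (hab : Function.Exact a b) (hb : Function.Surjective b) {i : ℕ}
    (hA : ExtVanishes R i A N) (hB : ExtVanishes R (i + 1) B N) : ExtVanishes R (i + 1) D N := by
  obtain ⟨w, hS⟩ := exists_shortExact ha hab hb
  refine subsingleton_of_forall_eq 0 fun x => ?_
  obtain ⟨y, rfl⟩ := Abelian.Ext.contravariant_sequence_exact₃ hS _ x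
    (@Subsingleton.elim _ hB _ _) (add_comm 1 i)
  rw [@Subsingleton.elim _ hA y 0, Abelian.Ext.comp_zero]

/-- Degree one of the long exact sequence: a class on `D` is the connecting image of some `g : A →
N`, and that image is zero once `g` extends to `B`. -/
theorem ExtVanishes.one_of_exact {a : A →ₗ[R] B} {b : B →ₗ[R] D} (ha : Function.Injective a)
    (hab : Function.Exact a b) (hb : Function.Surjective b)
    (hext : ∀ g : A →ₗ[R] N, ∃ h : B →ₗ[R] N, h ∘ₗ a = g)
    (hB : ExtVanishes R 1 B N) : ExtVanishes R 1 D N := by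
  obtain ⟨w, hS⟩ := exists_shortExact ha hab hb
  refine subsingleton_of_forall_eq 0 fun x => ?_
  obtain ⟨y, rfl⟩ := Abelian.Ext.contravariant_sequence_exact₃ hS _ x
    (@Subsingleton.elim _ hB _ _) (add_zero 1)
  obtain ⟨g, rfl⟩ := (Abelian.Ext.mk₀_bijective _ _).2 y
  obtain ⟨h, hh⟩ := hext g.hom
  have : g = ModuleCat.ofHom a ≫ ModuleCat.ofHom h := by
    ext x; exact (LinearMap.congr_fun hh x).symm
  rw [this, ← Abelian.Ext.mk₀_comp_mk₀]
  exact hS.extClass_comp_assoc _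

theorem ExtVanishes.exists_extension {a : A →ₗ[R] B} {b : B →ₗ[R] D} (ha : Function.Injective a)
    (hab : Function.Exact a b) (hb : Function.Surjective b)
    (hD : ExtVanishes R 1 D N) (g : A →ₗ[R] N) : ∃ h : B →ₗ[R] N, h ∘ₗ a = g := by
  obtain ⟨w, hS⟩ := exists_shortExact ha hab hb
  obtain ⟨y, hy⟩ := Abelian.Ext.contravariant_sequence_exact₁ hS _
    (Abelian.Ext.mk₀ (ModuleCat.ofHom g)) (add_zero 1) (@Subsingleton.elim _ hD _ _)
  obtain ⟨h, rfl⟩ := (Abelian.Ext.mk₀_bijective _ _).2 y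
  rw [Abelian.Ext.mk₀_comp_mk₀] at hy
  have := (Abelian.Ext.mk₀_bijective _ _).1 hy
  exact ⟨h.hom, congrArg ModuleCat.Hom.hom this⟩

/-- If the identity of `A` is a finite sum of maps factoring through `B`, then vanishing of
`Ext^i(B, N)` implies vanishing of `Ext^i(A, N)`. -/
theorem ExtVanishes.of_sum_comp_eq_id {ι : Type*} [Fintype ι] (s : ι → A →ₗ[R] B)
    (t : ι → B →ₗ[R] A) (hst : ∑ j, t j ∘ₗ s j = LinearMap.id) {i : ℕ}
    (hB : ExtVanishes R i B N) : ExtVanishes R i A N := by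
  refine subsingleton_of_forall_eq 0 fun x => ?_
  have hid : 𝟙 (ModuleCat.of R A) = ∑ j, ModuleCat.ofHom (s j) ≫ ModuleCat.ofHom (t j) := by
    apply ModuleCat.hom_ext
    rw [ModuleCat.hom_sum]
    exact hst.symm
  rw [← Abelian.Ext.mk₀_id_comp x, hid, Abelian.Ext.mk₀_sum, Abelian.Ext.sum_comp]
  refine Finset.sum_eq_zero fun j _ => ?_
  rw [← Abelian.Ext.mk₀_comp_mk₀_assoc, @Subsingleton.elim _ hB ((Abelian.Ext.mk₀ (ModuleCat.ofHom (t j))).comp x (zero_add i)) 0,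
    Abelian.Ext.comp_zero]

theorem ExtVanishes.of_linearEquiv (e : A ≃ₗ[R] B) {i : ℕ}
    (hB : ExtVanishes R i B N) : ExtVanishes R i A N :=
  .of_sum_comp_eq_id (ι := Unit) (fun _ => e.toLinearMap) (fun _ => e.symm.toLinearMap)
    (by ext; simp) hB

theorem extVanishes_of_projective [Module.Projective R A] {i : ℕ} (hi : 0 < i) :
    ExtVanishes R i A N := by
  have : Projective (ModuleCat.of R A) := (IsProjective.iff_projective A).1 inferInstance
  obtain ⟨j, rfl⟩ := Nat.exists_eq_succ_of_ne_zero hi.ne'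
  exact Abelian.Ext.subsingleton_of_projective _ _ _

end Ext

/-! ### Finite projective modules and their `C`-duals. -/

section Dual

variable {R : Type u} [CommRing R] {C P : Type u} [AddCommGroup C] [Module R C]
  [AddCommGroup P] [Module R P]

/-- A finite projective module has a dual basis. -/
theorem exists_dualBasis (R P : Type*) [CommRing R] [AddCommGroup P] [Module R P]
    [Module.Finite R P] [Module.Projective R P] :
    ∃ (n : ℕ) (v : Fin n → P) (φ : Fin n → P →ₗ[R] R), ∀ x, ∑ j, φ j x • v j = x := by
  obtain ⟨n, g, hg⟩ := Module.Finite.exists_fin' R P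
  obtain ⟨s, hs⟩ := g.exists_rightInverse_of_surjective (LinearMap.range_eq_top.2 hg)
  refine ⟨n, fun j => g (Pi.single j 1), fun j => LinearMap.proj j ∘ₗ s, fun x => ?_⟩
  conv_rhs => rw [← LinearMap.id_apply (R := R) x, ← hs, LinearMap.comp_apply,
    pi_eq_sum_univ' (s x), map_sum]
  refine Finset.sum_congr rfl fun j _ => ?_
  rw [← map_smul]
  congr 1

theorem projective_dual [Module.Finite R P] [Module.Projective R P] :
    Module.Projective R (Module.Dual R P) := by
  infer_instance

theorem dualTensorHom_surjective [Module.Finite R P] [Module.Projective R P] :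
    Function.Surjective (dualTensorHom R P C) := by
  obtain ⟨n, v, φ, h⟩ := exists_dualBasis R P
  refine fun χ => ⟨∑ j, φ j ⊗ₜ χ (v j), LinearMap.ext fun x => ?_⟩
  conv_rhs => rw [← h x]
  simp [LinearMap.sum_apply]

theorem finite_linearMap [Module.Finite R P] [Module.Projective R P] [Module.Finite R C] :
    Module.Finite R (P →ₗ[R] C) :=
  Module.Finite.of_surjective _ dualTensorHom_surjective

theorem dualTensorHom_injective [Module.Finite R P] [Module.Projective R P] :
    Function.Injective (dualTensorHom R P C) := by
  obtain ⟨n, v, φ, h⟩ := exists_dualBasis R P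
  refine Function.LeftInverse.injective (g := fun χ => ∑ j, φ j ⊗ₜ[R] χ (v j)) fun t => ?_
  induction t with
  | zero => simp
  | add a b ha hb =>
    simp only [map_add, LinearMap.add_apply, tmul_add, Finset.sum_add_distrib]
    exact congrArg₂ _ ha hb
  | tmul ψ c =>
    simp only [dualTensorHom_apply, ← smul_tmul]
    rw [← sum_tmul]
    congr 1
    ext x
    conv_rhs => rw [← h x]
    simp [LinearMap.sum_apply, mul_comm]

theorem extVanishes_linearMap [Module.Finite R P] [Module.Projective R P] {N : Type u}
    [AddCommGroup N] [Module R N] {i : ℕ} (hC : ExtVanishes R i C N) :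
    ExtVanishes R i (P →ₗ[R] C) N := by
  obtain ⟨n, v, φ, h⟩ := exists_dualBasis R P
  refine .of_sum_comp_eq_id (fun j => LinearMap.applyₗ (v j))
    (fun j => dualTensorHom R P C ∘ₗ TensorProduct.mk R (Module.Dual R P) C (φ j)) ?_ hC
  ext χ x
  conv_rhs => rw [LinearMap.id_apply, ← h x]
  simp [LinearMap.sum_apply]

theorem IsSemidualizing.exists_smul (hC : IsSemidualizing R C) (g : C →ₗ[R] C) :
    ∃ r : R, ∀ c, g c = r • c := by
  obtain ⟨r, rfl⟩ := hC.homothety_bijective.2 g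
  exact ⟨r, fun _ => rfl⟩

theorem IsSemidualizing.eq_zero (hC : IsSemidualizing R C) {r : R} (h : ∀ c : C, r • c = 0) :
    r = 0 :=
  hC.homothety_bijective.1 (by rw [map_zero]; exact LinearMap.ext h)

theorem IsSemidualizing.biduality_bijective (hC : IsSemidualizing R C)
    [Module.Finite R P] [Module.Projective R P] :
    Function.Bijective (LinearMap.applyₗ : P →ₗ[R] (P →ₗ[R] C) →ₗ[R] C) := by
  obtain ⟨n, v, φ, h⟩ := exists_dualBasis R P
  have hzero : ∀ x : P, (∀ χ : P →ₗ[R] C, χ x = 0) → x = 0 := fun x hx => by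
    rw [← h x]
    refine Finset.sum_eq_zero fun j _ => ?_
    have : φ j x = 0 := hC.eq_zero fun c => hx (dualTensorHom R P C (φ j ⊗ₜ c))
    rw [this, zero_smul]
  refine ⟨(injective_iff_map_eq_zero _).2 fun x hx => hzero x fun χ => LinearMap.congr_fun hx χ,
    fun G => ?_⟩
  -- Restricted to `φ j ⊗ C`, `G` is an endomorphism of `C`, hence a homothety `r j`; these scalars
  -- are the coordinates of the preimage.
  choose r hr using fun j =>
    hC.exists_smul (G ∘ₗ dualTensorHom R P C ∘ₗ TensorProduct.mk R (Module.Dual R P) C (φ j))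
  refine ⟨∑ j, r j • v j, LinearMap.ext fun χ => ?_⟩
  have hχ : χ = ∑ j, dualTensorHom R P C (φ j ⊗ₜ χ (v j)) := by
    ext x
    conv_lhs => rw [← h x]
    simp [LinearMap.sum_apply]
  conv_rhs => rw [hχ, map_sum]
  rw [LinearMap.applyₗ_apply_apply, map_sum]
  exact Finset.sum_congr rfl fun j _ => (map_smul χ _ _).trans (hr j _).symm

end Dual

/-! ### `G_C`-dimension zero means totally `C`-reflexive. -/

section Reflexive

variable {R : Type u} [CommRing R] {C X M : Type u} [AddCommGroup C] [Module R C]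
  [AddCommGroup X] [Module R X] [AddCommGroup M] [Module R M]

theorem IsTotallyReflexive.of_linearEquiv (e : X ≃ₗ[R] M) (h : IsTotallyReflexive R C X) :
    IsTotallyReflexive R C M where
  finite := have := h.finite; Module.Finite.equiv e
  biduality_bijective := by
    let e₁ : (X →ₗ[R] C) ≃ₗ[R] (M →ₗ[R] C) := e.congrLeft C R
    let e₂ : ((X →ₗ[R] C) →ₗ[R] C) ≃ₗ[R] ((M →ₗ[R] C) →ₗ[R] C) := e₁.congrLeft C R
    have : (LinearMap.applyₗ : M →ₗ[R] (M →ₗ[R] C) →ₗ[R] C) =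
        e₂.toLinearMap ∘ₗ LinearMap.applyₗ ∘ₗ e.symm.toLinearMap := by
      ext x χ
      change χ x = χ (e (e.symm x))
      rw [e.apply_symm_apply]
    rw [this]
    exact e₂.bijective.comp (h.biduality_bijective.comp e.symm.bijective)
  ext_self i hi := (h.ext_self i hi).of_linearEquiv e.symm
  ext_dual i hi := (h.ext_dual i hi).of_linearEquiv (e.congrLeft C R).symm

theorem gDim_eq_zero (h : IsTotallyReflexive R C X) : gDim R C X = 0 := by
  have : HasGResolution R C X 0 :=
    ⟨fun n => match n with | 0 => ModuleCat.of R X | _ + 1 => ModuleCat.of R PUnit,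
      fun _ => 0, LinearMap.id, fun i hi => by obtain rfl := Nat.le_zero.1 hi; exact h,
      fun i hi => by
        obtain ⟨j, rfl⟩ := Nat.exists_eq_succ_of_ne_zero hi.ne'
        exact inferInstanceAs (Subsingleton PUnit),
      Function.surjective_id,
      fun x => ⟨fun hx => ⟨0, hx.symm⟩, by rintro ⟨y, rfl⟩; rfl⟩,
      fun i x => ⟨fun _ => ⟨0, @Subsingleton.elim PUnit _ _ _⟩, by rintro ⟨y, rfl⟩; rfl⟩⟩
  exact le_antisymm (iInf₂_le 0 this) bot_le

theorem isTotallyReflexive_of_gDim_eq_zero (h : gDim R C M = 0) : IsTotallyReflexive R C M := by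
  have h0 : HasGResolution R C M 0 := by
    by_contra h0
    have : (1 : ℕ∞) ≤ gDim R C M := by
      refine le_iInf₂ fun n hn => ?_
      rcases n with _ | n
      · exact absurd hn h0
      · exact_mod_cast Nat.succ_pos n
    rw [h] at this
    simp at this
  obtain ⟨X, d, ε, hX, hs, hε, hd, -⟩ := h0
  have := hs 1 one_pos
  refine (hX 0 le_rfl).of_linearEquiv (LinearEquiv.ofBijective ε
    ⟨(injective_iff_map_eq_zero _).2 fun x hx => ?_, hε⟩)
  obtain ⟨y, rfl⟩ := (hd x).1 hx
  rw [Subsingleton.elim y 0, map_zero]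

end Reflexive

/-! ### Superfluous submodules and projective covers. -/

section Superfluous

variable {R : Type u} [CommRing R] {P M : Type u} [AddCommGroup P] [Module R P]
  [AddCommGroup M] [Module R M]

theorem mem_jacobson_iff_forall_isMaximal {r : R} :
    r ∈ Ring.jacobson R ↔ ∀ m : Ideal R, m.IsMaximal → r ∈ m := by
  rw [Ring.jacobson_eq_sInf_isMaximal, Submodule.mem_sInf]
  rfl

/-- If `φ x` avoids a maximal ideal `m`, then `x` and `φ⁻¹(m)` span `P`, so `φ⁻¹(m) = P`, a
contradiction. -/
theorem IsSuperfluous.apply_mem_jacobson {K : Submodule R P} (hK : IsSuperfluous K) {x : P}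
    (hx : x ∈ K) (φ : P →ₗ[R] R) : φ x ∈ Ring.jacobson R := by
  refine mem_jacobson_iff_forall_isMaximal.2 fun m hm => ?_
  by_contra hxm
  obtain ⟨r, i, hi, hr⟩ := hm.exists_inv hxm
  have htop : K ⊔ Submodule.comap φ m = ⊤ := by
    refine eq_top_iff.2 fun y _ => Submodule.mem_sup.2
      ⟨(φ y * r) • x, K.smul_mem _ hx, y - (φ y * r) • x, ?_, add_sub_cancel _ _⟩
    have : φ (y - (φ y * r) • x) = φ y * i := by
      rw [map_sub, map_smul, smul_eq_mul]
      linear_combination (-φ y) * hr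
    rw [Submodule.mem_comap, this]
    exact m.mul_mem_left _ hi
  have := hK _ htop
  exact hxm (Submodule.mem_comap.1 (this ▸ Submodule.mem_top))

/-- Coordinates in a dual basis give `K ⊆ J P`; then Nakayama applies. -/
theorem isSuperfluous_of_apply_mem_jacobson [Module.Finite R P] [Module.Projective R P]
    {K : Submodule R P} (h : ∀ x ∈ K, ∀ φ : P →ₗ[R] R, φ x ∈ Ring.jacobson R) :
    IsSuperfluous K := by
  intro K' htop
  obtain ⟨n, v, φ, hv⟩ := exists_dualBasis R P
  refine eq_top_iff.2 (Submodule.le_of_le_smul_of_le_jacobson_bot (I := Ring.jacobson R)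
    Module.Finite.fg_top Ideal.jacobson_bot.ge ?_)
  rw [← htop, sup_comm]
  refine sup_le_sup_left (fun x hx => ?_) _
  rw [← hv x]
  exact Submodule.sum_mem _ fun j _ =>
    Submodule.smul_mem_smul (h x hx _) (by rw [sup_comm, htop]; trivial)

theorem IsProjectiveCover.finite [Module.Finite R M] {π : P →ₗ[R] M} (h : IsProjectiveCover π) :
    Module.Finite R P := by
  obtain ⟨n, g, hg⟩ := Module.Finite.exists_fin' R M
  obtain ⟨s, hs⟩ := Module.projective_lifting_property π g h.surjective
  refine Module.Finite.of_surjective s (LinearMap.range_eq_top.1 (h.superfluous _ ?_))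
  refine eq_top_iff.2 fun y _ => ?_
  obtain ⟨z, hz⟩ := hg (π y)
  refine Submodule.mem_sup.2 ⟨y - s z, ?_, s z, ⟨z, rfl⟩, sub_add_cancel _ _⟩
  rw [LinearMap.mem_ker, map_sub, ← hz, ← hs, LinearMap.comp_apply, sub_self]

/-- Projective covers are unique up to isomorphism. -/
theorem IsProjectiveCover.exists_linearEquiv {P' : Type u} [AddCommGroup P'] [Module R P']
    {π : P →ₗ[R] M} {π' : P' →ₗ[R] M} (h : IsProjectiveCover π) (h' : IsProjectiveCover π') :
    ∃ e : P' ≃ₗ[R] P, ∀ x, π (e x) = π' x := by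
  have := h.projective
  have := h'.projective
  have key : ∀ {A B : Type u} [AddCommGroup A] [Module R A] [AddCommGroup B] [Module R B]
      {α : A →ₗ[R] M} {β : B →ₗ[R] M} (_ : Function.Surjective α) (_ : IsSuperfluous (LinearMap.ker β))
      (s : A →ₗ[R] B) (_ : β ∘ₗ s = α), Function.Surjective s := by
    intro A B _ _ _ _ α β hα hβ s hs
    refine LinearMap.range_eq_top.1 (hβ _ (eq_top_iff.2 fun y _ => ?_))
    obtain ⟨z, hz⟩ := hα (β y)
    refine Submodule.mem_sup.2 ⟨y - s z, ?_, s z, ⟨z, rfl⟩, sub_add_cancel _ _⟩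
    rw [LinearMap.mem_ker, map_sub, ← hz, ← hs, LinearMap.comp_apply, sub_self]
  obtain ⟨g, hg⟩ := Module.projective_lifting_property π' π h'.surjective
  obtain ⟨s, hs⟩ := g.exists_rightInverse_of_surjective
    (LinearMap.range_eq_top.2 (key h.surjective h'.superfluous g hg))
  have hπs : π ∘ₗ s = π' := by rw [← hg, LinearMap.comp_assoc, hs, LinearMap.comp_id]
  refine ⟨LinearEquiv.ofBijective s ⟨Function.LeftInverse.injective (g := g)
    (LinearMap.congr_fun hs), key h'.surjective h.superfluous s hπs⟩, LinearMap.congr_fun hπs⟩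

end Superfluous

/-! ### Local idempotents, existence of projective covers, and stability. -/

section Semiperfect

variable {R : Type u} [CommRing R] {M : Type u} [AddCommGroup M] [Module R M]

/-- An idempotent `e` such that `R e` is zero or a local ring. -/
structure IsLocalIdempotent (e : R) : Prop where
  idem : e * e = e
  mem_or : ∀ r, r * e ∈ Ring.jacobson R ∨ ∃ s, s * (r * e) = e

/-- In the semisimple ring `R/J` the ideal `m/J` has a complement, generated by an idempotent that
`m/J` kills. A lift `e` satisfies `m e ⊆ J`, while an element outside `m` is invertible on `R e`. -/
theorem IsSemiperfect.exists_isLocalIdempotent (hR : IsSemiperfect R) (m : Ideal R)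
    [hm : m.IsMaximal] : ∃ e, e ∉ m ∧ IsLocalIdempotent e := by
  obtain ⟨hss, hlift⟩ := hR
  set q := Ideal.Quotient.mk (Ring.jacobson R)
  have hq : Function.Surjective q := Ideal.Quotient.mk_surjective
  have hJm : Ring.jacobson R ≤ m := fun r hr => mem_jacobson_iff_forall_isMaximal.1 hr m hm
  have hmem : ∀ r, q r ∈ m.map q → r ∈ m := fun r hr => by
    have : r ∈ (m.map q).comap q := hr
    rw [Ideal.comap_map_of_surjective q hq, ← RingHom.ker_eq_comap_bot, Ideal.mk_ker,
      sup_eq_left.2 hJm] at this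
    exact this
  obtain ⟨K, hK⟩ := exists_isCompl (m.map q)
  obtain ⟨a, ha, b, hb, hab⟩ := Submodule.mem_sup.1
    (hK.sup_eq_top ▸ Submodule.mem_top : (1 : R ⧸ Ring.jacobson R) ∈ m.map q ⊔ K)
  have hzero : ∀ x ∈ m.map q, x * b = 0 := fun x hx =>
    (Submodule.disjoint_def.1 hK.disjoint) _ (Ideal.mul_mem_right _ _ hx) (K.smul_mem x hb)
  have hbb : b * b = b := by
    have := hzero a ha
    linear_combination b * hab - this
  obtain ⟨e, he, hqe⟩ := hlift b hbb
  change q e = b at hqe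
  refine ⟨e, fun hem => ?_, he, fun r => ?_⟩
  · have hb0 : b = 0 := by
      rw [← hbb]; exact hzero b (hqe ▸ Ideal.mem_map_of_mem q hem)
    rw [hb0, add_zero] at hab
    exact hm.ne_top (m.eq_top_of_isUnit_mem
      (hmem 1 (by rw [map_one, ← hab]; exact ha)) isUnit_one)
  · have hJ : ∀ r ∈ m, r * e ∈ Ring.jacobson R := fun r hr => by
      rw [← Ideal.Quotient.eq_zero_iff_mem]
      change q (r * e) = 0
      rw [map_mul, hqe]
      exact hzero _ (Ideal.mem_map_of_mem q hr)
    by_cases hr : r ∈ m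
    · exact Or.inl (hJ r hr)
    · obtain ⟨s, i, hi, hs⟩ := hm.exists_inv hr
      have hj := hJ i hi
      rw [← Ideal.jacobson_bot, Ideal.mem_jacobson_bot] at hj
      obtain ⟨w, hw⟩ := hj (-1)
      refine Or.inr ⟨(↑w⁻¹ : R) * s, ?_⟩
      have hw1 : (↑w⁻¹ : R) * (i * e * -1 + 1) = 1 := by rw [← hw, Units.inv_mul]
      have he' : e * e = e := he
      linear_combination e * hw1 + (↑w⁻¹ : R) * e * hs + (↑w⁻¹ : R) * i * he'

theorem IsSemiperfect.span_isLocalIdempotent (hR : IsSemiperfect R) :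
    Ideal.span {e : R | IsLocalIdempotent e} = ⊤ := by
  by_contra h
  obtain ⟨m, hm, hle⟩ := Ideal.exists_le_maximal _ h
  obtain ⟨e, hem, he⟩ := hR.exists_isLocalIdempotent m
  exact hem (hle (Ideal.subset_span he))

/-- Over a semiperfect ring a finite module is generated by a finite family whose members are
fixed by local idempotents. -/
theorem IsSemiperfect.exists_generators (hR : IsSemiperfect R) [Module.Finite R M] :
    ∃ (n : ℕ) (x : Fin n → M), (∀ j, ∃ e : R, IsLocalIdempotent e ∧ e • x j = x j) ∧
      Submodule.span R (Set.range x) = ⊤ := by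
  set S : Set M := {y | ∃ e : R, IsLocalIdempotent e ∧ e • y = y} with hS
  have hspan : Submodule.span R S = ⊤ := by
    refine eq_top_iff.2 fun y _ => ?_
    have hle : Ideal.span {e : R | IsLocalIdempotent e} ≤
        Submodule.comap (LinearMap.toSpanSingleton R M y) (Submodule.span R S) := by
      refine Submodule.span_le.2 fun e he => Submodule.subset_span ⟨e, he, ?_⟩
      rw [LinearMap.toSpanSingleton_apply, smul_smul, he.idem]
    have := hle (hR.span_isLocalIdempotent ▸ Submodule.mem_top : (1 : R) ∈ _)
    simpa using this
  obtain ⟨T, hTS, hT⟩ := (Submodule.fg_span_iff_fg_span_finset_subset S).1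
    (hspan ▸ Module.Finite.fg_top)
  refine ⟨T.card, fun j => (T.equivFin.symm j : M), fun j => hTS (T.equivFin.symm j).2, ?_⟩
  have : Set.range (fun j => (T.equivFin.symm j : M)) = T := by
    ext y
    exact ⟨by rintro ⟨j, rfl⟩; exact (T.equivFin.symm j).2,
      fun hy => ⟨T.equivFin ⟨y, hy⟩, by simp⟩⟩
  rw [this, ← hT, hspan]

/-- Finite modules over a semiperfect ring have projective covers. -/
theorem IsSemiperfect.exists_projectiveCover (hR : IsSemiperfect R) [Module.Finite R M] :
    ∃ (P : ModuleCat.{u} R) (π : P →ₗ[R] M), IsProjectiveCover π := by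
  classical
  -- The number of generators is taken least; this will force the coordinates of every relation into
  -- `J`.
  have hex := hR.exists_generators (M := M)
  obtain ⟨x, hx, hspan⟩ := Nat.find_spec hex
  have hmin := fun k (hk : k < Nat.find hex) => Nat.find_min hex hk
  generalize Nat.find hex = n at x hx hspan hmin
  choose e he hex using hx
  -- the projection of `R ^ n` onto the product of the `R eⱼ`
  let ρ : (Fin n → R) →ₗ[R] (Fin n → R) := LinearMap.pi fun j => e j • LinearMap.proj j
  have hρ : ∀ r j, ρ r j = e j * r j := fun r j => rfl
  let P : Submodule R (Fin n → R) := LinearMap.range ρ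
  have hP : ∀ r ∈ P, ∀ j, e j * r j = r j := by
    rintro _ ⟨r, rfl⟩ j
    rw [hρ, ← mul_assoc, (he j).idem]
  have hsplit : ρ.rangeRestrict ∘ₗ P.subtype = LinearMap.id := by
    ext r j
    exact hP r r.2 j
  have hproj : Module.Projective R P := Module.Projective.of_split _ _ hsplit
  have hfin : Module.Finite R P := inferInstance
  let σ : (Fin n → R) →ₗ[R] M := Fintype.linearCombination R x
  have hσ : ∀ r, σ r = ∑ j, r j • x j := fun r => rfl
  have hσρ : ∀ r, σ (ρ r) = σ r := fun r => by
    rw [hσ, hσ]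
    refine Finset.sum_congr rfl fun j _ => ?_
    rw [hρ, mul_comm, mul_smul, hex]
  refine ⟨ModuleCat.of R P, σ ∘ₗ P.subtype, hproj, fun y => ?_,
    isSuperfluous_of_apply_mem_jacobson fun r hr φ => ?_⟩
  · have hy : y ∈ LinearMap.range σ := by
      rw [Fintype.range_linearCombination, hspan]; trivial
    obtain ⟨r, rfl⟩ := hy
    exact ⟨⟨ρ r, r, rfl⟩, hσρ r⟩
  · have hr0 : ∑ j, (r : Fin n → R) j • x j = 0 := hr
    have hcoord : ∀ k, (r : Fin n → R) k ∈ Ring.jacobson R := by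
      intro k
      have hk := hP r r.2 k
      -- A coordinate outside `J` is invertible on `R eₖ`, so `xₖ` is a combination of the other
      -- generators, against minimality.
      rcases (he k).mem_or ((r : Fin n → R) k) with h | ⟨s, hs⟩
      · rwa [mul_comm, hk] at h
      exfalso
      rw [mul_comm _ (e k), hk] at hs
      obtain ⟨n, rfl⟩ := Nat.exists_eq_succ_of_ne_zero (Fin.pos k).ne'
      refine hmin n n.lt_succ_self ⟨fun j => x (k.succAbove j), fun j => ⟨_, he _, hex _⟩, ?_⟩
      rw [eq_top_iff, ← hspan, Submodule.span_le]
      rintro _ ⟨j, rfl⟩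
      have hmem : ∀ j, x (k.succAbove j) ∈
          Submodule.span R (Set.range fun j => x (k.succAbove j)) :=
        fun j => Submodule.subset_span ⟨j, rfl⟩
      rcases eq_or_ne j k with rfl | hjk
      · rw [Fin.sum_univ_succAbove _ j] at hr0
        have : x j = -(s • ∑ i, (r : Fin (n + 1) → R) (j.succAbove i) • x (j.succAbove i)) := by
          rw [← hex j, ← hs, mul_smul, ← smul_neg]
          exact congrArg _ (eq_neg_of_add_eq_zero_left hr0)
        rw [this]
        exact Submodule.neg_mem _ (Submodule.smul_mem _ _
          (Submodule.sum_mem _ fun i _ => Submodule.smul_mem _ _ (hmem i)))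
      · obtain ⟨i, rfl⟩ := Fin.exists_succAbove_eq hjk
        exact hmem i
    have hsum : r = ∑ j, (r : Fin n → R) j • ρ.rangeRestrict (Pi.single j 1) := by
      conv_lhs => rw [← LinearMap.id_apply (R := R) r, ← hsplit, LinearMap.comp_apply,
        pi_eq_sum_univ' (P.subtype r), map_sum]
      refine Finset.sum_congr rfl fun j _ => ?_
      rw [map_smul]
      rfl
    rw [hsum, map_sum]
    refine Ideal.sum_mem _ fun j _ => ?_
    rw [map_smul, smul_eq_mul]
    exact Ideal.mul_mem_right _ _ (hcoord j)

/-- A value `φ x` outside a maximal ideal `m` becomes invertible on `R e` for a local idempotent `e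
∉ m`. Then `φ` splits off the span of `e x`, a non-zero projective summand. -/
theorem IsStable.apply_mem_jacobson (hR : IsSemiperfect R) (hM : IsStable R M)
    (φ : M →ₗ[R] R) (x : M) : φ x ∈ Ring.jacobson R := by
  refine mem_jacobson_iff_forall_isMaximal.2 fun m hm => ?_
  by_contra hxm
  obtain ⟨e, hem, he⟩ := hR.exists_isLocalIdempotent m
  rcases he.mem_or (φ x) with h | ⟨s, hs⟩
  · exact (hm.isPrime.mem_or_mem (mem_jacobson_iff_forall_isMaximal.1 h m hm)).elim hxm hem
  set y := e • x with hy
  let ψ : M →ₗ[R] R := s • φ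
  have hψy : ψ y = e := by
    change s * φ (e • x) = e
    rw [map_smul, smul_eq_mul, mul_comm e, hs]
  have hey : e • y = y := by rw [hy, smul_smul, he.idem]
  let j : R →ₗ[R] Submodule.span R {y} :=
    LinearMap.toSpanSingleton R _ ⟨y, Submodule.mem_span_singleton_self y⟩
  have hj : ∀ z : Submodule.span R {y}, j (ψ z) = z := by
    rintro ⟨z, hz⟩
    obtain ⟨r, rfl⟩ := Submodule.mem_span_singleton.1 hz
    refine Subtype.ext ?_
    change ψ (r • y) • y = r • y
    rw [map_smul, hψy, smul_eq_mul, mul_smul, hey]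
  have hbot := hM.no_summand _ _ (LinearMap.isCompl_of_proj (f := j ∘ₗ ψ) hj)
    (Module.Projective.of_split (ψ ∘ₗ Submodule.subtype _) j (LinearMap.ext hj))
  rw [Submodule.span_singleton_eq_bot] at hbot
  rw [hbot, map_zero] at hψy
  exact hem (hψy ▸ m.zero_mem)

/-- A projective summand inherits the condition on functionals, so it is superfluous in itself,
hence zero. -/
theorem isStable_of_apply_mem_jacobson [Module.Finite R M]
    (h : ∀ (φ : M →ₗ[R] R) (x : M), φ x ∈ Ring.jacobson R) : IsStable R M where
  finite := inferInstance
  no_summand P Q hPQ hP := by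
    have hpr : ∀ x : P, P.projectionOnto Q hPQ x = x := Submodule.projectionOnto_apply_left hPQ
    have : Module.Finite R P := Module.Finite.of_surjective (P.projectionOnto Q hPQ)
      fun x => ⟨x, hpr x⟩
    have hsup : IsSuperfluous (⊤ : Submodule R P) :=
      isSuperfluous_of_apply_mem_jacobson fun x _ φ => by
        have := h (φ ∘ₗ P.projectionOnto Q hPQ) x
        rwa [LinearMap.comp_apply, hpr] at this
    have := hsup ⊥ (sup_bot_eq _)
    rw [eq_bot_iff]
    intro x hx
    have hx' : (⟨x, hx⟩ : P) ∈ (⊥ : Submodule R P) := this ▸ Submodule.mem_top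
    exact congrArg Subtype.val ((Submodule.mem_bot R).1 hx')

end Semiperfect

/-! ### Passing total reflexivity from `M` to the cokernel of `Hom(M, C) → Hom(P, C)`. -/

section Reflexivity

variable {R : Type u} [CommRing R] {C M P Z : Type u} [AddCommGroup C] [Module R C]
  [AddCommGroup M] [Module R M] [AddCommGroup P] [Module R P] [AddCommGroup Z] [Module R Z]

theorem exists_comp_eq_of_ker_le {π : P →ₗ[R] M} (hπ : Function.Surjective π) {χ : P →ₗ[R] Z}
    (h : LinearMap.ker π ≤ LinearMap.ker χ) : ∃ g : M →ₗ[R] Z, g ∘ₗ π = χ := by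
  refine ⟨(LinearMap.ker π).liftQ χ h ∘ₗ (π.quotKerEquivOfSurjective hπ).symm.toLinearMap,
    LinearMap.ext fun x => ?_⟩
  have : (π.quotKerEquivOfSurjective hπ).symm (π x) = Submodule.Quotient.mk x := by
    rw [LinearEquiv.symm_apply_eq]; rfl
  change (LinearMap.ker π).liftQ χ h ((π.quotKerEquivOfSurjective hπ).symm (π x)) = χ x
  rw [this]; rfl

/-- If `Z` is the cokernel of `Hom(M, C) → Hom(P, C)` for a presentation `P → M` with kernel `K`,
then the `C`-dual of `Z` is `K`. -/
theorem exists_dual_equiv_ker {π : P →ₗ[R] M} {q : (P →ₗ[R] C) →ₗ[R] Z}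
    (hP : Function.Bijective (LinearMap.applyₗ : P →ₗ[R] (P →ₗ[R] C) →ₗ[R] C))
    (hM : Function.Injective (LinearMap.applyₗ : M →ₗ[R] (M →ₗ[R] C) →ₗ[R] C))
    (hq : Function.Surjective q) (hker : ∀ χ, q χ = 0 ↔ ∃ g : M →ₗ[R] C, g ∘ₗ π = χ) :
    ∃ e : (Z →ₗ[R] C) ≃ₗ[R] LinearMap.ker π, ∀ (g : Z →ₗ[R] C) (χ : P →ₗ[R] C), χ (e g : P) = g (q χ) := by
  let b := LinearEquiv.ofBijective _ hP
  have hb : ∀ (G : (P →ₗ[R] C) →ₗ[R] C) (χ : P →ₗ[R] C), χ (b.symm G) = G χ := fun G χ =>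
    LinearMap.congr_fun (b.apply_symm_apply G) χ
  let a : (Z →ₗ[R] C) →ₗ[R] P := b.symm.toLinearMap ∘ₗ LinearMap.lcomp R C q
  have ha : ∀ (g : Z →ₗ[R] C) (χ : P →ₗ[R] C), χ (a g) = g (q χ) := fun g χ => hb _ χ
  have hmem : ∀ g, a g ∈ LinearMap.ker π := fun g => by
    refine LinearMap.mem_ker.2 ((injective_iff_map_eq_zero _).1 hM _ (LinearMap.ext fun h => ?_))
    change (h ∘ₗ π) (a g) = 0
    rw [ha, (hker _).2 ⟨h, rfl⟩, map_zero]
  refine ⟨LinearEquiv.ofBijective (a.codRestrict _ hmem) ⟨?_, fun z => ?_⟩, fun g χ => ha g χ⟩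
  · refine (injective_iff_map_eq_zero _).2 fun g hg => LinearMap.ext fun z => ?_
    obtain ⟨χ, rfl⟩ := hq z
    have hg0 : a g = 0 := congrArg Subtype.val hg
    rw [← ha, hg0, map_zero, LinearMap.zero_apply]
  · have hle : LinearMap.ker q ≤ LinearMap.ker (LinearMap.applyₗ (R := R) (M₂ := C) (z : P)) := by
      intro χ hχ
      obtain ⟨h, rfl⟩ := (hker χ).1 hχ
      change h (π z) = 0
      rw [LinearMap.mem_ker.1 z.2, map_zero]
    obtain ⟨g, hg⟩ := exists_comp_eq_of_ker_le hq hle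
    refine ⟨g, Subtype.ext (hP.1 (LinearMap.ext fun χ => ?_))⟩
    exact (ha g χ).trans (LinearMap.congr_fun hg χ)

/-- The cokernel of `Hom(M, C) → Hom(P, C)`, where `P → M` is surjective with `P` finite
projective and `M` is totally `C`-reflexive, is totally `C`-reflexive. -/
theorem IsTotallyReflexive.of_dual_presentation (hC : IsSemidualizing R C)
    (hM : IsTotallyReflexive R C M) [Module.Finite R P] [Module.Projective R P]
    {π : P →ₗ[R] M} (hπ : Function.Surjective π) {q : (P →ₗ[R] C) →ₗ[R] Z}
    (hq : Function.Surjective q) (hker : ∀ χ, q χ = 0 ↔ ∃ g : M →ₗ[R] C, g ∘ₗ π = χ) :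
    IsTotallyReflexive R C Z := by
  have := hC.finite
  have : Module.Finite R (P →ₗ[R] C) := finite_linearMap
  have hP := hC.biduality_bijective (P := P)
  obtain ⟨e, he⟩ := exists_dual_equiv_ker hP hM.biduality_bijective.1 hq hker
  have hπ' : Function.Injective (LinearMap.lcomp R C π) := fun g h hgh =>
    (LinearMap.cancel_right hπ).1 hgh
  have hex : Function.Exact (LinearMap.lcomp R C π) q := hker
  have hKex : Function.Exact (LinearMap.ker π).subtype π := LinearMap.exact_subtype_ker_map π
  have hPC : ∀ i, 0 < i → ExtVanishes R i (P →ₗ[R] C) C := fun i hi =>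
    extVanishes_linearMap (hC.ext_self i hi)
  refine ⟨Module.Finite.of_surjective q hq, ⟨?_, fun G => ?_⟩, fun i hi => ?_, fun i hi => ?_⟩
  · refine (injective_iff_map_eq_zero _).2 fun z hz => ?_
    obtain ⟨χ, rfl⟩ := hq z
    refine (hker χ).2 (exists_comp_eq_of_ker_le hπ fun x hx => ?_)
    have := he (e.symm ⟨x, hx⟩) χ
    rw [e.apply_symm_apply] at this
    exact this.trans (LinearMap.congr_fun hz _)
  -- `G` becomes a map `ker π → C`; since `Ext¹(M, C) = 0`, it extends to some `χ` on `P`, and `q χ`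
  -- is the preimage.
  · obtain ⟨χ, hχ⟩ := (hM.ext_self 1 one_pos).exists_extension
      (Submodule.injective_subtype _) hKex hπ (G ∘ₗ e.symm.toLinearMap)
    refine ⟨q χ, LinearMap.ext fun g => ?_⟩
    have := LinearMap.congr_fun hχ (e g)
    simp only [LinearMap.comp_apply, LinearEquiv.coe_coe, e.symm_apply_apply] at this
    exact (he g χ).symm.trans this
  · rcases i with _ | _ | i
    · exact absurd hi (lt_irrefl 0)
    -- By biduality, a map `Hom(M, C) → C` is evaluation at some `π x`, which extends to evaluation
    -- at `x` on `Hom(P, C)`.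
    · refine .one_of_exact hπ' hex hq (fun g => ?_) (hPC 1 one_pos)
      obtain ⟨m, rfl⟩ := hM.biduality_bijective.2 g
      obtain ⟨x, rfl⟩ := hπ m
      exact ⟨LinearMap.applyₗ x, rfl⟩
    · exact .of_exact_right hπ' hex hq (hM.ext_dual _ i.succ_pos) (hPC _ (Nat.succ_pos _))
  · exact .of_linearEquiv e (.of_exact_left (Submodule.injective_subtype _) hKex hπ
      (extVanishes_of_projective hi) (hM.ext_self _ i.succ_pos))

end Reflexivity

/-! ### Injectivity after tensoring with `C`. -/

section Tensor

variable {R : Type u} [CommRing R] {C L L' : Type u} [AddCommGroup C] [Module R C]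
  [AddCommGroup L] [Module R L] [AddCommGroup L'] [Module R L']

/-- When `Hom(C, N) = 0`, some element of the annihilator of `C` is regular on `N`; `C` is faithful,
so that element is `0`. -/
theorem IsSemidualizing.subsingleton_of_subsingleton_linearMap [IsNoetherianRing R]
    (hC : IsSemidualizing R C) {N : Type u} [AddCommGroup N] [Module R N] [Module.Finite R N]
    (h : Subsingleton (C →ₗ[R] N)) : Subsingleton N := by
  have := hC.finite
  obtain ⟨r, hr, hreg⟩ := IsSMulRegular.subsingleton_linearMap_iff.1 h
  have hr0 : r = 0 := hC.eq_zero (Module.mem_annihilator.1 hr)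
  exact ⟨fun a b => hreg (by simp [hr0])⟩

/-- Tensoring with `C` preserves injectivity of `L → L'` if the natural map
`L → Hom(C, L ⊗ C)` is surjective and `L' → Hom(C, L' ⊗ C)` is injective. -/
theorem IsSemidualizing.rTensor_injective [IsNoetherianRing R] (hC : IsSemidualizing R C)
    [Module.Finite R L] {i : L →ₗ[R] L'} (hi : Function.Injective i)
    (hL : Function.Surjective (TensorProduct.mk R L C : L → C →ₗ[R] L ⊗[R] C))
    (hL' : Function.Injective (TensorProduct.mk R L' C : L' → C →ₗ[R] L' ⊗[R] C)) :
    Function.Injective (i.rTensor C) := by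
  have := hC.finite
  have : Subsingleton (C →ₗ[R] LinearMap.ker (i.rTensor C)) := by
    refine subsingleton_of_forall_eq 0 fun g => ?_
    obtain ⟨x, hx⟩ := hL (Submodule.subtype _ ∘ₗ g)
    have hix : i x = 0 := hL' <| LinearMap.ext fun c => by
      have h1 : (x ⊗ₜ[R] c) = (g c : L ⊗[R] C) := LinearMap.congr_fun hx c
      have h2 : i.rTensor C (g c : L ⊗[R] C) = 0 := (g c).2
      rw [← h1, LinearMap.rTensor_tmul] at h2
      simpa using h2
    have hx0 : x = 0 := hi (by rw [hix, map_zero])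
    refine LinearMap.ext fun c => Subtype.ext ?_
    have h1 : (x ⊗ₜ[R] c) = (g c : L ⊗[R] C) := LinearMap.congr_fun hx c
    rw [← h1, hx0, zero_tmul]
    rfl
  have := hC.subsingleton_of_subsingleton_linearMap this
  rw [← LinearMap.ker_eq_bot]
  exact Submodule.eq_bot_of_subsingleton

theorem IsSemidualizing.mk_dual_injective (hC : IsSemidualizing R C) {P : Type u}
    [AddCommGroup P] [Module R P] :
    Function.Injective (TensorProduct.mk R (Module.Dual R P) C :
      Module.Dual R P → C →ₗ[R] Module.Dual R P ⊗[R] C) := by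
  refine (injective_iff_map_eq_zero _).2 fun φ hφ => LinearMap.ext fun y => ?_
  refine hC.eq_zero fun c => ?_
  have : dualTensorHom R P C (φ ⊗ₜ c) y = 0 := by
    have h : φ ⊗ₜ[R] c = 0 := LinearMap.congr_fun hφ c
    rw [h, map_zero, LinearMap.zero_apply]
  exact this

end Tensor

/-! ### The exact sequence ending in `L ⊗ C`, and the functionals on `L`. -/

section Linked

variable {R : Type u} [CommRing R] {C M P₀ P₁ L : Type u}
  [AddCommGroup C] [Module R C] [AddCommGroup M] [Module R M] [AddCommGroup P₀] [Module R P₀]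
  [AddCommGroup P₁] [Module R P₁] [AddCommGroup L] [Module R L]
  [Module.Finite R P₀] [Module.Projective R P₀] [Module.Finite R P₁] [Module.Projective R P₁]
  {f : P₁ →ₗ[R] P₀} {π : P₀ →ₗ[R] M} {p : Module.Dual R P₀ →ₗ[R] L} {i : L →ₗ[R] Module.Dual R P₁}

/-- For a presentation `P₁ → P₀ → M → 0` and `L` the image of `P₀* → P₁*`, the module `L ⊗ C` is
the cokernel of `Hom(M, C) → Hom(P₀, C)`. -/
theorem exists_tensor_presentation [IsNoetherianRing R] (hC : IsSemidualizing R C) (hπ : Function.Surjective π)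
    (hf : Function.Exact f π) (hp : Function.Surjective p) (hi : Function.Injective i)
    (hip : i ∘ₗ p = f.dualMap)
    (hL : Function.Surjective (TensorProduct.mk R L C : L → C →ₗ[R] L ⊗[R] C)) :
    ∃ q : (P₀ →ₗ[R] C) →ₗ[R] L ⊗[R] C, Function.Surjective q ∧
      (∀ χ, q χ = 0 ↔ ∃ g : M →ₗ[R] C, g ∘ₗ π = χ) ∧
      ∀ ψ c, q (dualTensorHom R P₀ C (ψ ⊗ₜ c)) = p ψ ⊗ₜ c := by
  have : Module.Finite R (Module.Dual R P₀) := finite_linearMap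
  have : Module.Finite R L := Module.Finite.of_surjective p hp
  have hinj := hC.rTensor_injective hi hL hC.mk_dual_injective
  let E : (Module.Dual R P₀ ⊗[R] C) ≃ₗ[R] (P₀ →ₗ[R] C) :=
    LinearEquiv.ofBijective (dualTensorHom R P₀ C) ⟨dualTensorHom_injective,
      dualTensorHom_surjective⟩
  let q := p.rTensor C ∘ₗ E.symm.toLinearMap
  have hqE : ∀ t, q (E t) = p.rTensor C t := fun t =>
    congrArg (p.rTensor C) (E.symm_apply_apply t)
  -- Under `P₁* ⊗ C = Hom(P₁, C)`, the map `(i ⊗ C) ∘ q` is precomposition with `f`; as `i ⊗ C` is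
  -- injective, `q χ = 0` means that `χ` kills `ker π`.
  have hθ : ∀ χ, dualTensorHom R P₁ C (i.rTensor C (q χ)) = χ ∘ₗ f := by
    intro χ
    obtain ⟨t, rfl⟩ := E.surjective χ
    rw [hqE]
    induction t with
    | zero => simp
    | add a b ha hb => simp only [map_add, ha, hb, LinearMap.add_comp]
    | tmul ψ c =>
      rw [LinearMap.rTensor_tmul, LinearMap.rTensor_tmul]
      ext y
      have := LinearMap.congr_fun (LinearMap.congr_fun hip ψ) y
      change i (p ψ) y • c = ψ (f y) • c
      exact congrArg (· • c) this
  refine ⟨q, (LinearMap.rTensor_surjective C hp).comp E.symm.surjective, fun χ => ?_,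
    fun ψ c => (hqE (ψ ⊗ₜ c)).trans (LinearMap.rTensor_tmul _ _ _ _)⟩
  constructor
  · intro h
    have hχf : χ ∘ₗ f = 0 := by rw [← hθ, h, map_zero, map_zero]
    refine exists_comp_eq_of_ker_le hπ fun x hx => ?_
    obtain ⟨y, rfl⟩ := (hf x).1 hx
    exact LinearMap.congr_fun hχf y
  · rintro ⟨g, rfl⟩
    apply hinj
    apply dualTensorHom_injective
    rw [hθ, map_zero, map_zero, LinearMap.comp_assoc, hf.linearMap_comp_eq_zero, LinearMap.comp_zero]

/-- In the situation of `exists_tensor_presentation` with `M` a `C`-torsionless module, every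
functional on `L` is evaluation at an element of the kernel of `P₀ → M`. -/
theorem exists_mem_ker_eval (hC : IsSemidualizing R C)
    (hM : Function.Injective (LinearMap.applyₗ : M →ₗ[R] (M →ₗ[R] C) →ₗ[R] C))
    {q : (P₀ →ₗ[R] C) →ₗ[R] L ⊗[R] C} (hq : Function.Surjective q)
    (hker : ∀ χ, q χ = 0 ↔ ∃ g : M →ₗ[R] C, g ∘ₗ π = χ)
    (hqp : ∀ ψ c, q (dualTensorHom R P₀ C (ψ ⊗ₜ c)) = p ψ ⊗ₜ c) (φ : L →ₗ[R] R) :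
    ∃ z, π z = 0 ∧ ∀ ψ : Module.Dual R P₀, φ (p ψ) = ψ z := by
  obtain ⟨e, he⟩ := exists_dual_equiv_ker hC.biduality_bijective hM hq hker
  let g : L ⊗[R] C →ₗ[R] C := TensorProduct.lid R C ∘ₗ φ.rTensor C
  refine ⟨e g, (e g).2, fun ψ => ?_⟩
  rw [← sub_eq_zero]
  refine hC.eq_zero fun c => ?_
  have h : ψ (e g : P₀) • c = g (p ψ ⊗ₜ c) := by rw [← hqp, ← he]; rfl
  rw [sub_smul, h, sub_eq_zero]
  rfl

end Linked

/-! ### Computing `λM` and `λL` from one minimal presentation. -/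

section Lambda

variable {R : Type u} [CommRing R] {M P₀ P₁ L T : Type u}
  [AddCommGroup M] [Module R M] [AddCommGroup P₀] [Module R P₀]
  [AddCommGroup P₁] [Module R P₁] [AddCommGroup L] [Module R L] [AddCommGroup T] [Module R T]
  {f : P₁ →ₗ[R] P₀} {π : P₀ →ₗ[R] M}

/-- Functionals on `P₁*` are evaluations and `(f* ψ) y = ψ (f y)`, so the radical condition on `f`
is also the one on `f*`. -/
theorem isProjectiveCover_mkQ_range_dualMap [Module.Finite R P₁] [Module.Projective R P₁]
    (h : ∀ (y : P₁) (φ : P₀ →ₗ[R] R), φ (f y) ∈ Ring.jacobson R) :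
    IsProjectiveCover (LinearMap.range f.dualMap).mkQ where
  projective := projective_dual
  surjective := Submodule.mkQ_surjective _
  superfluous := by
    have : Module.Finite R (Module.Dual R P₁) := finite_linearMap
    have : Module.Projective R (Module.Dual R P₁) := projective_dual
    refine isSuperfluous_of_apply_mem_jacobson fun x hx φ => ?_
    rw [Submodule.ker_mkQ] at hx
    obtain ⟨ψ, rfl⟩ := hx
    obtain ⟨y, rfl⟩ := (Module.bijective_dual_eval R P₁).2 φ
    exact h y ψ

theorem IsProjectiveCover.linearEquiv_comp {ϖ : P₀ →ₗ[R] T} (h : IsProjectiveCover ϖ)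
    (e : T ≃ₗ[R] M) : IsProjectiveCover (e.toLinearMap ∘ₗ ϖ) where
  projective := h.projective
  surjective := e.surjective.comp h.surjective
  superfluous := by rw [LinearEquiv.ker_comp]; exact h.superfluous

theorem IsMinimalPresentation.finite_left [IsNoetherianRing R] [Module.Finite R P₀]
    (h : IsMinimalPresentation f π) : Module.Finite R P₁ :=
  h.cover_ker.finite

theorem IsMinimalPresentation.apply_mem_jacobson (h : IsMinimalPresentation f π) (y : P₁)
    (φ : P₀ →ₗ[R] R) : φ (f y) ∈ Ring.jacobson R :=
  h.cover.superfluous.apply_mem_jacobson (h.exact.apply_apply_eq_zero y) φ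

/-- `λ M` is the image of the dual of a minimal presentation of `M`. -/
theorem IsMinimalPresentation.exists_dual_factorization [Module.Finite R P₁]
    (h : IsMinimalPresentation f π) (eT : T ≃ₗ[R] Module.Dual R P₁ ⧸ LinearMap.range f.dualMap)
    (hL : IsSyzygy R T L) :
    ∃ (p : Module.Dual R P₀ →ₗ[R] L) (i : L →ₗ[R] Module.Dual R P₁),
      Function.Surjective p ∧ Function.Injective i ∧ i ∘ₗ p = f.dualMap := by
  have := h.cover_ker.projective
  obtain ⟨P, ϖ, hϖ, ⟨eL⟩⟩ := hL
  obtain ⟨e, he⟩ := (isProjectiveCover_mkQ_range_dualMap h.apply_mem_jacobson).exists_linearEquiv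
    (hϖ.linearEquiv_comp eT)
  have hker : ∀ x, e x ∈ LinearMap.range f.dualMap ↔ x ∈ LinearMap.ker ϖ := fun x => by
    rw [← Submodule.ker_mkQ (LinearMap.range f.dualMap), LinearMap.mem_ker, he, LinearMap.mem_ker]
    exact eT.map_eq_zero_iff
  let i : L →ₗ[R] Module.Dual R P₁ := e.toLinearMap ∘ₗ Submodule.subtype _ ∘ₗ eL.toLinearMap
  have hi : Function.Injective i :=
    e.injective.comp ((Submodule.injective_subtype _).comp eL.injective)
  have hrange : LinearMap.range i = LinearMap.range f.dualMap := by
    ext ψ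
    constructor
    · rintro ⟨l, rfl⟩
      exact (hker _).2 (eL l).2
    · intro hψ
      have : e.symm ψ ∈ LinearMap.ker ϖ := (hker _).1 (by rwa [e.apply_symm_apply])
      refine ⟨eL.symm ⟨_, this⟩, ?_⟩
      change e (eL (eL.symm ⟨e.symm ψ, this⟩) : P) = ψ
      rw [eL.apply_symm_apply, e.apply_symm_apply]
  let E := LinearEquiv.ofInjective i hi
  have hE : ∀ y, i (E.symm y) = y := fun y => congrArg Subtype.val (E.apply_symm_apply y)
  have hmem : ∀ ψ, f.dualMap ψ ∈ LinearMap.range i := fun ψ => hrange ▸ ⟨ψ, rfl⟩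
  refine ⟨E.symm.toLinearMap ∘ₗ f.dualMap.codRestrict _ hmem, i, fun l => ?_, hi,
    LinearMap.ext fun ψ => hE _⟩
  obtain ⟨ψ, hψ⟩ : i l ∈ LinearMap.range f.dualMap := hrange ▸ ⟨l, rfl⟩
  exact ⟨ψ, hi ((hE _).trans hψ)⟩

/-- If `M` is stable and every functional on `L = λ M` is evaluation at an element of the kernel
of `P₀ → M`, then `M` is `λ L`. -/
theorem IsMinimalPresentation.isLambda_of_exists_eval [IsNoetherianRing R] (hR : IsSemiperfect R)
    (hM : IsStable R M) (h : IsMinimalPresentation f π)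
    {p : Module.Dual R P₀ →ₗ[R] L} {i : L →ₗ[R] Module.Dual R P₁} (hp : Function.Surjective p)
    (hip : i ∘ₗ p = f.dualMap)
    (heval : ∀ φ : L →ₗ[R] R, ∃ z, π z = 0 ∧ ∀ ψ : Module.Dual R P₀, φ (p ψ) = ψ z) :
    IsLambda R L M := by
  have := hM.finite
  have := h.cover.projective
  have : Module.Finite R P₀ := h.cover.finite
  have : Module.Finite R (Module.Dual R P₀) := finite_linearMap
  have : Module.Projective R (Module.Dual R P₀) := projective_dual
  have hev := Module.bijective_dual_eval R P₀
  have hip' : ∀ ψ y, i (p ψ) y = ψ (f y) := fun ψ y =>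
    LinearMap.congr_fun (LinearMap.congr_fun hip ψ) y
  -- `ker p` consists of functionals that factor through `M`, where stability puts their values in
  -- `J`.
  have hpJ : ∀ ψ ∈ LinearMap.ker p, ∀ x, ψ x ∈ Ring.jacobson R := fun ψ hψ x => by
    obtain ⟨φ, rfl⟩ := exists_comp_eq_of_ker_le (χ := ψ) h.cover.surjective fun x hx => by
      obtain ⟨y, rfl⟩ := (h.exact x).1 hx
      rw [LinearMap.mem_ker, ← hip', LinearMap.mem_ker.1 hψ, map_zero, LinearMap.zero_apply]
    exact hM.apply_mem_jacobson hR φ _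
  have hcover : IsProjectiveCover p :=
    ⟨projective_dual, hp, isSuperfluous_of_apply_mem_jacobson fun ψ hψ φ => by
      obtain ⟨x, rfl⟩ := hev.2 φ
      exact hpJ ψ hψ x⟩
  obtain ⟨Q, κ, hκ⟩ := hR.exists_projectiveCover (M := LinearMap.ker p)
  have := hκ.projective
  have := hκ.finite
  let k : Q →ₗ[R] Module.Dual R P₀ := Submodule.subtype _ ∘ₗ κ
  have hk : ∀ ψ, p ψ = 0 ↔ ψ ∈ Set.range k := fun ψ =>
    ⟨fun hψ => by
      obtain ⟨y, hy⟩ := hκ.surjective ⟨ψ, hψ⟩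
      exact ⟨y, congrArg Subtype.val hy⟩, by rintro ⟨y, rfl⟩; exact (κ y).2⟩
  have hpres : IsMinimalPresentation k p := ⟨hcover, hk, hκ⟩
  let a : P₀ →ₗ[R] Module.Dual R Q := k.dualMap ∘ₗ Module.Dual.eval R P₀
  have hrange : LinearMap.range a = LinearMap.range k.dualMap :=
    LinearMap.range_comp_of_range_eq_top _ (LinearMap.range_eq_top.2 hev.2)
  -- `a z = 0` means that evaluation at `z` kills `ker p`, so it descends to `L`; `heval` then
  -- places `z` in `ker π`.
  have hker : LinearMap.ker π = LinearMap.ker a := by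
    ext z
    constructor
    · intro hz
      obtain ⟨x, rfl⟩ := (h.exact z).1 hz
      refine LinearMap.mem_ker.2 (LinearMap.ext fun y => ?_)
      change k y (f x) = 0
      rw [← hip', (hk _).2 ⟨y, rfl⟩, map_zero, LinearMap.zero_apply]
    · intro hz
      obtain ⟨φ, hφ⟩ := exists_comp_eq_of_ker_le (χ := Module.Dual.eval R P₀ z) hp fun ψ hψ => by
        obtain ⟨y, rfl⟩ := (hk ψ).1 hψ
        exact LinearMap.congr_fun hz y
      obtain ⟨z', hz', hzz'⟩ := heval φ
      have : z = z' := hev.1 (LinearMap.ext fun ψ => by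
        rw [← hφ]; exact hzz' ψ)
      rw [this]; exact hz'
  refine ⟨ModuleCat.of R (Module.Dual R Q ⧸ LinearMap.range k.dualMap),
    ⟨Q, ModuleCat.of R (Module.Dual R P₀), k, p, hpres, ⟨LinearEquiv.refl _ _⟩⟩,
    ModuleCat.of R (Module.Dual R Q), (LinearMap.range k.dualMap).mkQ,
    isProjectiveCover_mkQ_range_dualMap hpres.apply_mem_jacobson,
    ⟨(π.quotKerEquivOfSurjective h.cover.surjective).symm.trans
      ((Submodule.quotEquivOfEq _ _ hker).trans (a.quotKerEquivRange.trans
        (LinearEquiv.ofEq _ _ ?_)))⟩⟩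
  exact hrange.trans (Submodule.ker_mkQ _).symm

end Lambda
end Linkage

theorem mainTheorem7 {R : Type u} [CommRing R] [IsNoetherianRing R]
    (hR : Linkage.IsSemiperfect R)
    {C : Type u} [AddCommGroup C] [Module R C] (hC : Linkage.IsSemidualizing R C)
    {M : Type u} [AddCommGroup M] [Module R M]
    (hM : Linkage.IsStable R M) (hdim : Linkage.gDim R C M = 0)
    {L : Type u} [AddCommGroup L] [Module R L]
    (hL : Linkage.IsLambda R M L) (hA : Linkage.InAuslanderClass R C L) :
    Linkage.IsHorizontallyLinked R M ∧
      Linkage.IsStable R L ∧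
      Linkage.gDim R C (L ⊗[R] C) = 0 := by
  have hL' := hL
  obtain ⟨T, ⟨P₁, P₀, f, π, hpres, ⟨eT⟩⟩, hsyz⟩ := hL
  have hrefl := Linkage.isTotallyReflexive_of_gDim_eq_zero hdim
  have := hM.finite
  have := hpres.cover.projective
  have := hpres.cover_ker.projective
  have : Module.Finite R P₀ := hpres.cover.finite
  have : Module.Finite R P₁ := hpres.finite_left
  have : Module.Finite R (Module.Dual R P₀) := Linkage.finite_linearMap
  obtain ⟨p, i, hp, hi, hip⟩ := hpres.exists_dual_factorization eT hsyz
  have : Module.Finite R L := Module.Finite.of_surjective p hp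
  obtain ⟨q, hq, hker, hqp⟩ := Linkage.exists_tensor_presentation hC hpres.cover.surjective
    hpres.exact hp hi hip hA.unit_bijective.2
  have heval := Linkage.exists_mem_ker_eval hC hrefl.biduality_bijective.1 hq hker hqp
  refine ⟨⟨ModuleCat.of R L, hL', hpres.isLambda_of_exists_eval hR hM hp hip heval, hL'⟩,
    Linkage.isStable_of_apply_mem_jacobson fun φ l => ?_,
    Linkage.gDim_eq_zero (hrefl.of_dual_presentation hC hpres.cover.surjective hq hker)⟩
  obtain ⟨z, hz, hφ⟩ := heval φ
  obtain ⟨ψ, rfl⟩ := hp l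
  rw [hφ]
  exact hpres.cover.superfluous.apply_mem_jacobson hz ψ
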